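/- **Setting.** There are $k\ge 1$ agents and $T\ge 0$ rounds. A realization is a family of bits $\rho=(\rho_i(t))_{i\in[k],\,t\in[T]}$; the bit $\rho_i(t)\in\{0,1\}$ says whether agent $i$ is clicked if she is played at round $t$. A randomized allocation rule $\mathcal A$ draws a random seed $\omega$ from a distribution that depends neither on the bids nor on $\rho$, and, given $\omega$ and the bid vector $b\in[0,\infty)^k$, plays one agent $\mathcal A(b;\rho;t)$ in each round $t$; it is online, i.e. for each seed the choice at round $t$ depends on $\rho$ only through the bits of the agents played in the rounds before $t$. Let $\mathcal A_i(b;\rho;t)$ be the indicator of $\mathcal A(b;\rho;t)=i$, and let $\mathcal C_i(b;\rho)=\sum_t\rho_i(t)\mathcal A_i(b;\rho;t)$ be the number of clicks of agent $i$. A payment rule $\mathcal P$ charges each agent $i$ an amount $\mathcal P_i(b;\rho)$ which depends only on the seed, the bids and the observed clicks (the bits of the agents that were played). The mechanism $(\mathcal A,\mathcal P)$ is *normalized* if $0\le \mathcal P_i(b;\rho)\le b_i\,\mathcal C_i(b;\rho)$ for all $i,b,\rho$ and every seed. It is *weakly truthful* if for every realization $\rho$, agent $i$, value $v_i\ge 0$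 and bid vector $b$, $$\mathbb E\big[v_i\,\mathcal C_i(v_i,b_{-i};\rho)-\mathcal P_i(v_i,b_{-i};\rho)\big]\ \ge\ \mathbb E\big[v_i\,\mathcal C_i(b;\rho)-\mathcal P_i(b;\rho)\big],$$ the expectation being over the seed. The worst-case regret of $\mathcal A$ against an oblivious adversary is $$R(T;v_{\max})=\sup_{\rho,\ v\in[0,v_{\max}]^k}\Big(\max_i v_i\sum_{t=1}^T\rho_i(t)-\sum_{t=1}^T\sum_{i=1}^k v_i\,\rho_i(t)\,\mathbb E[\mathcal A_i(v;\rho;t)]\Big).$$ **Algorithm PSim.** Its parameters are a number $P$ of phases, with $Pk\le T$, and $\varepsilon\ge 0$. The first $PQ$ rounds, $Q=\lfloor T/P\rfloor$, are divided into $P$ phases of $Q$ consecutive rounds. Independently in each phase, $k$ distinct rounds (the exploration rounds) are picked uniformly at random and assigned randomly to the $k$ agents. All weights $w_i(0)$ equal $1$, and $w_i(p)=w_i(p-1)\,(1+\varepsilon)^{\rho_i(t)\,b_i/\max_j b_j}$, where $t$ is the exploration round of phase $p$ assigned to $i$ (the exponent is $0$ if all bids are $0$). In an exploration round the assigned agent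 is played. In every other round of phase $p$ an agent is drawn, with fresh randomness, with probabilities $w_i(p-1)/\sum_j w_j(p-1)$, and the click is discarded; in the remaining rounds $t>PQ$ (all rounds, if $P=0$) the current weights are used in the same way. We take $P=\min\{\lfloor(\log k)^{1/3}(T/k)^{2/3}\rfloor,\lfloor T/k\rfloor\}$ and $\varepsilon=(k\log k/T)^{1/3}$ (with $\varepsilon=0$ if $T=0$). **Statement.** There is an absolute constant $C>0$ such that for all $k\ge 1$ and $T\ge 0$ there is a payment rule $\mathcal P$ for the allocation rule PSim such that the mechanism $(\mathrm{PSim},\mathcal P)$ is normalized and weakly truthful, and for all $v_{\max}\ge 0$ its worst-case regret satisfies $$R(T;v_{\max})\le C\,(k\log k)^{1/3}\,T^{2/3}\,v_{\max}.$$ -/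

import Mathlib

open MeasureTheory

/-! ## The adversarial multi-armed bandit mechanism design problem

There are `k` agents (indexed by `Fin k`) and `T` rounds (indexed by `Fin T`). -/

/-- A realization: the bit `ρ i t` tells whether agent `i` is clicked if she is played at round
`t`.  An oblivious adversary fixes the whole realization in advance. -/
abbrev Realization (k T : ℕ) : Type := Fin k → Fin T → Bool

/-- The bit `ρ i t` as a real number, `0` or `1`. -/
def click {k T : ℕ} (ρ : Realization k T) (i : Fin k) (t : Fin T) : ℝ := if ρ i t then 1 else 0

/-- A randomized online allocation rule.  The random seed is drawn from the probability
distribution `law`, which depends neither on the bids nor on the realization; given the seed,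
`alloc ω b ρ t` is the agent played at round `t` when the bids are `b` and the realization is
`ρ`. -/
structure AllocationRule (k T : ℕ) where
  /-- the space of random seeds -/
  Seed : Type
  /-- the events about the random seed -/
  [seedSpace : MeasurableSpace Seed]
  /-- the distribution of the random seed -/
  law : Measure Seed
  [isProbability : IsProbabilityMeasure law]
  /-- the agent that is played -/
  alloc : Seed → (Fin k → ℝ) → Realization k T → Fin T → Fin k
  measurable_alloc : ∀ b ρ t, Measurable fun ω => alloc ω b ρ t
  /-- Online: the agent chosen at round `t` depends on the realization only through the clicks
  observed before round `t`, i.e. the bits of the agents played in the earlier rounds. -/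
  online : ∀ ω b ρ ρ' t,
    (∀ s, s < t → ρ (alloc ω b ρ s) s = ρ' (alloc ω b ρ s) s) →
      alloc ω b ρ t = alloc ω b ρ' t

attribute [instance] AllocationRule.seedSpace AllocationRule.isProbability

/-- A payment rule for the allocation rule `A`: `pay ω b ρ i` is the total payment charged to
agent `i` at the end of the `T` rounds. -/
structure PaymentRule {k T : ℕ} (A : AllocationRule k T) where
  /-- the payment of each agent -/
  pay : A.Seed → (Fin k → ℝ) → Realization k T → Fin k → ℝ
  measurable_pay : ∀ b ρ i, Measurable fun ω => pay ω b ρ i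
  /-- Payments depend on the realization only through the observed clicks. -/
  observed : ∀ ω b ρ ρ',
    (∀ t, ρ (A.alloc ω b ρ t) t = ρ' (A.alloc ω b ρ t) t) → pay ω b ρ = pay ω b ρ'

namespace AllocationRule

variable {k T : ℕ} (A : AllocationRule k T)

/-- The number of clicks that agent `i` receives. -/
noncomputable def clicks (ω : A.Seed) (b : Fin k → ℝ) (ρ : Realization k T) (i : Fin k) : ℝ :=
  ∑ t, if A.alloc ω b ρ t = i then click ρ i t else 0

/-- The probability, over the random seed, that agent `i` is played at round `t`. -/
noncomputable def playProb (b : Fin k → ℝ) (ρ : Realization k T) (t : Fin T) (i : Fin k) : ℝ :=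
  A.law.real {ω | A.alloc ω b ρ t = i}

/-- The regret for the values `v` and the realization `ρ`: the welfare of the best
time-invariant allocation minus the expected welfare of `A` when all agents bid truthfully. -/
noncomputable def regret [NeZero k] (v : Fin k → ℝ) (ρ : Realization k T) : ℝ :=
  (Finset.univ.sup' Finset.univ_nonempty fun i => v i * ∑ t, click ρ i t) -
    ∑ t, ∑ i, v i * click ρ i t * A.playProb v ρ t i

/-- The worst-case regret over all realizations and all values in `[0, vmax]`. -/
noncomputable def worstCaseRegret [NeZero k] (vmax : ℝ) : EReal :=
  ⨆ (v : Fin k → ℝ) (_ : ∀ i, v i ∈ Set.Icc 0 vmax) (ρ : Realization k T), (A.regret v ρ : EReal)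

end AllocationRule

namespace PaymentRule

variable {k T : ℕ} {A : AllocationRule k T} (P : PaymentRule A)

/-- The mechanism `(A, P)` is normalized: for every random seed, the payment of each agent lies
between `0` and her bid times the number of clicks she got. -/
def IsNormalized : Prop :=
  ∀ (ω : A.Seed) (b : Fin k → ℝ), (∀ j, 0 ≤ b j) → ∀ (ρ : Realization k T) (i : Fin k),
    0 ≤ P.pay ω b ρ i ∧ P.pay ω b ρ i ≤ b i * A.clicks ω b ρ i

/-- The utility of agent `i` with value `x` per click when the bids are `b`. -/
noncomputable def utility (ω : A.Seed) (x : ℝ) (b : Fin k → ℝ) (ρ : Realization k T)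
    (i : Fin k) : ℝ :=
  x * A.clicks ω b ρ i - P.pay ω b ρ i

/-- The mechanism `(A, P)` is weakly truthful: for each realization, bidding her true value
maximizes the utility of an agent in expectation over the random seed, whatever the bids of the
other agents are. -/
def IsWeaklyTruthful : Prop :=
  ∀ (ρ : Realization k T) (i : Fin k) (x : ℝ), 0 ≤ x → ∀ b : Fin k → ℝ, (∀ j, 0 ≤ b j) →
    ∫ ω, P.utility ω x b ρ i ∂A.law ≤ ∫ ω, P.utility ω x (Function.update b i x) ρ i ∂A.law

end PaymentRule

/-! ## The algorithm PSim -/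

/-- The random choice of exploration rounds for `P` phases of `Q` rounds each: `e p i` is the
position, inside phase `p`, of the exploration round assigned to agent `i`.  A uniformly random
`e` picks, independently in each phase, `k` rounds without replacement and assigns them randomly
to the `k` agents. -/
def Exploration (k P Q : ℕ) : Type := Fin P → (Fin k ↪ Fin Q)

namespace Exploration

variable {k P Q T : ℕ}

noncomputable instance : Fintype (Exploration k P Q) := inferInstanceAs (Fintype (Fin P → (Fin k ↪ Fin Q)))

instance : MeasurableSpace (Exploration k P Q) := ⊤

instance : DiscreteMeasurableSpace (Exploration k P Q) := ⟨fun _ => trivial⟩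

theorem nonempty_of_le (h : 0 < P → k ≤ Q) : Nonempty (Exploration k P Q) :=
  ⟨fun p => Fin.castLEEmb (h p.pos)⟩

/-- The exploration round of phase `p` assigned to agent `i`, as a round of the whole game (the
phase `p` consists of the rounds `p * Q, …, p * Q + Q - 1`). -/
def round (hT : P * Q ≤ T) (e : Exploration k P Q) (p : Fin P) (i : Fin k) : Fin T :=
  ⟨p * Q + e p i, by
    have h1 := (e p i).isLt
    have h2 : (p.val + 1) * Q ≤ P * Q := Nat.mul_le_mul_right Q p.isLt
    rw [Nat.add_mul, one_mul] at h2
    omega⟩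

/-- The weight of agent `i` after the first `p` phases: it starts at `1`, and the exploration
round of agent `i` in a phase multiplies it by `(1 + ε) ^ (ρ i t * b i / max b)`. -/
noncomputable def weight [NeZero k] (hT : P * Q ≤ T) (e : Exploration k P Q) (ε : ℝ)
    (b : Fin k → ℝ) (ρ : Realization k T) : ℕ → Fin k → ℝ
  | 0, _ => 1
  | p + 1, i =>
    if h : p < P then
      weight hT e ε b ρ p i *
        (1 + ε) ^ (click ρ i (e.round hT ⟨p, h⟩ i) * b i /
          Finset.univ.sup' Finset.univ_nonempty b)
    else weight hT e ε b ρ p i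

/-- The distribution over the agents used in an exploitation round `t`: proportional to the
weights after the phases that precede the one of `t`. -/
noncomputable def dist [NeZero k] (hT : P * Q ≤ T) (e : Exploration k P Q) (ε : ℝ)
    (b : Fin k → ℝ) (ρ : Realization k T) (t : Fin T) (i : Fin k) : ℝ :=
  e.weight hT ε b ρ (t / Q) i / ∑ j, e.weight hT ε b ρ (t / Q) j

end Exploration

/-- The first element of a finite set of agents (the agent `0` if the set is empty). -/
def firstAgent {k : ℕ} [NeZero k] (s : Finset (Fin k)) : Fin k :=
  if h : s.Nonempty then s.min' h else 0

open Classical in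
/-- Sampling from a distribution `γ` on the agents with a uniform random `u ∈ [0, 1]`: the first
agent `i` with `u < γ 0 + ⋯ + γ i`. -/
noncomputable def sample {k : ℕ} [NeZero k] (γ : Fin k → ℝ) (u : ℝ) : Fin k :=
  firstAgent (Finset.univ.filter fun i => u < ∑ j ∈ Finset.Iic i, γ j)

theorem measurable_sample {k : ℕ} [NeZero k] (γ : Fin k → ℝ) : Measurable (sample γ) := by
  classical
  have key : ∀ s : Finset (Fin k), MeasurableSet
      {u : ℝ | (Finset.univ.filter fun i => u < ∑ j ∈ Finset.Iic i, γ j) = s} := by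
    intro s
    have : {u : ℝ | (Finset.univ.filter fun i => u < ∑ j ∈ Finset.Iic i, γ j) = s} =
        ⋂ i : Fin k, if i ∈ s then Set.Iio (∑ j ∈ Finset.Iic i, γ j)
          else Set.Ici (∑ j ∈ Finset.Iic i, γ j) := by
      ext u
      simp only [Set.mem_ofPred_eq, Set.mem_iInter, Finset.ext_iff, Finset.mem_filter,
        Finset.mem_univ, true_and]
      refine forall_congr' fun i => ?_
      by_cases hi : i ∈ s <;> simp [hi]
    rw [this]
    refine MeasurableSet.iInter fun i => ?_
    split_ifs
    · exact measurableSet_Iio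
    · exact measurableSet_Ici
  refine measurable_to_countable' fun i => ?_
  have : sample γ ⁻¹' {i} = ⋃ s ∈ {s : Finset (Fin k) | firstAgent s = i},
      {u : ℝ | (Finset.univ.filter fun i => u < ∑ j ∈ Finset.Iic i, γ j) = s} := by
    ext u
    simp [sample]
  rw [this]
  exact MeasurableSet.biUnion (Set.to_countable _) fun s _ => key s

open Classical in
/-- The agent that PSim plays at round `t`: the assigned agent if `t` is an exploration round,
and otherwise an agent drawn from the current distribution by means of `u t`.  If `P * Q < T`,
the remaining rounds at the end are exploitation rounds. -/
noncomputable def psimAlloc {k P Q T : ℕ} [NeZero k] (hT : P * Q ≤ T) (ε : ℝ)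
    (e : Exploration k P Q) (u : Fin T → unitInterval) (b : Fin k → ℝ) (ρ : Realization k T)
    (t : Fin T) : Fin k :=
  if h : ∃ i, ∃ p, e.round hT p i = t then h.choose else sample (e.dist hT ε b ρ t) (u t)

theorem Exploration.round_inj {k P Q T : ℕ} (hT : P * Q ≤ T) (e : Exploration k P Q)
    {p p' : Fin P} {i i' : Fin k} (h : e.round hT p i = e.round hT p' i') : i = i' := by
  have h0 : (p : ℕ) * Q + e p i = p' * Q + e p' i' := congrArg Fin.val h
  have h1 := (e p i).isLt
  have h2 := (e p' i').isLt
  have hQ : 0 < Q := by omega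
  have hp : (p : ℕ) = p' := by
    have := congrArg (· / Q) h0
    simpa [mul_comm _ Q, Nat.mul_add_div hQ, Nat.div_eq_of_lt h1, Nat.div_eq_of_lt h2] using this
  have hp' : p = p' := Fin.ext hp
  subst hp'
  exact (e p).injective (Fin.ext (by omega))

theorem psimAlloc_round {k P Q T : ℕ} [NeZero k] (hT : P * Q ≤ T) (ε : ℝ)
    (e : Exploration k P Q) (u : Fin T → unitInterval) (b : Fin k → ℝ) (ρ : Realization k T)
    (p : Fin P) (i : Fin k) : psimAlloc hT ε e u b ρ (e.round hT p i) = i := by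
  have h : ∃ i', ∃ p', e.round hT p' i' = e.round hT p i := ⟨i, p, rfl⟩
  rw [psimAlloc, dif_pos h]
  obtain ⟨p', hp'⟩ := h.choose_spec
  exact e.round_inj hT hp'

theorem Exploration.weight_congr {k P Q T : ℕ} [NeZero k] (hT : P * Q ≤ T)
    (e : Exploration k P Q) (ε : ℝ) (b : Fin k → ℝ) (ρ ρ' : Realization k T) (m : ℕ)
    (h : ∀ (p : Fin P) (i : Fin k), (p : ℕ) < m →
      ρ i (e.round hT p i) = ρ' i (e.round hT p i)) :
    ∀ i, e.weight hT ε b ρ m i = e.weight hT ε b ρ' m i := by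
  induction m with
  | zero => intro i; rfl
  | succ m ih =>
    intro i
    have ih' := ih (fun p i hp => h p i (by omega)) i
    by_cases hm : m < P
    · simp only [weight, hm, dite_true, ih', click, h ⟨m, hm⟩ i (Nat.lt_succ_self m)]
    · simp only [weight, hm, dite_false, ih']

theorem psimAlloc_online {k P Q T : ℕ} [NeZero k] (hT : P * Q ≤ T) (ε : ℝ)
    (e : Exploration k P Q) (u : Fin T → unitInterval) (b : Fin k → ℝ) (ρ ρ' : Realization k T)
    (t : Fin T)
    (h : ∀ s, s < t → ρ (psimAlloc hT ε e u b ρ s) s = ρ' (psimAlloc hT ε e u b ρ s) s) :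
    psimAlloc hT ε e u b ρ t = psimAlloc hT ε e u b ρ' t := by
  have hw := e.weight_congr hT ε b ρ ρ' (t / Q) (by
    intro p i hp
    have hlt : e.round hT p i < t := by
      have h1 := (e p i).isLt
      have h2 : (p.val + 1) * Q ≤ (t / Q) * Q := Nat.mul_le_mul_right Q hp
      have h3 := Nat.div_mul_le_self (t : ℕ) Q
      have h4 : ((e.round hT p i : Fin T) : ℕ) = p * Q + e p i := rfl
      rw [Nat.add_mul, one_mul] at h2
      exact Fin.lt_def.2 (by omega)
    have := h _ hlt
    rwa [psimAlloc_round] at this)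
  have hd : e.dist hT ε b ρ t = e.dist hT ε b ρ' t := by
    funext i
    simp only [Exploration.dist, hw]
  simp only [psimAlloc, hd]

theorem measurable_psimAlloc {k P Q T : ℕ} [NeZero k] (hT : P * Q ≤ T) (ε : ℝ)
    (b : Fin k → ℝ) (ρ : Realization k T) (t : Fin T) :
    Measurable fun ω : Exploration k P Q × (Fin T → unitInterval) =>
      psimAlloc hT ε ω.1 ω.2 b ρ t := by
  refine measurable_from_prod_countable_right fun e => ?_
  by_cases h : ∃ i, ∃ p, e.round hT p i = t
  · have h1 : (fun u => psimAlloc hT ε e u b ρ t) = fun _ => h.choose := by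
      funext u
      exact dif_pos h
    exact h1 ▸ measurable_const
  · have h1 : (fun u => psimAlloc hT ε e u b ρ t) = fun u => sample (e.dist hT ε b ρ t) (u t) := by
      funext u
      exact dif_neg h
    exact h1 ▸ (measurable_sample _).comp (measurable_subtype_coe.comp (measurable_pi_apply t))

/-- PSim with `P` phases of `⌊T / P⌋` rounds each and with parameter `ε`.  The random seed
consists of a uniformly random choice of the exploration rounds and, independently, one uniform
random number in `[0, 1]` for each round. -/
noncomputable def psim (k T P : ℕ) [NeZero k] (ε : ℝ) (hP : P * k ≤ T) : AllocationRule k T :=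
  haveI hT : P * (T / P) ≤ T := Nat.mul_div_le T P
  haveI : Nonempty (Exploration k P (T / P)) :=
    Exploration.nonempty_of_le fun h => (Nat.le_div_iff_mul_le h).2 (by rwa [mul_comm])
  { Seed := Exploration k P (T / P) × (Fin T → unitInterval)
    law := (PMF.uniformOfFintype (Exploration k P (T / P))).toMeasure.prod volume
    alloc := fun ω => psimAlloc hT ε ω.1 ω.2
    measurable_alloc := measurable_psimAlloc hT ε
    online := fun ω => psimAlloc_online hT ε ω.1 ω.2 }

/-- The number of phases `(log k)^(1/3) * (T / k)^(2/3)`, rounded down, and at most `⌊T / k⌋` so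
that every phase has room for `k` exploration rounds. -/
noncomputable def psimPhases (k T : ℕ) : ℕ :=
  min ⌊Real.log k ^ (1 / 3 : ℝ) * ((T : ℝ) / k) ^ (2 / 3 : ℝ)⌋₊ (T / k)

/-- The parameter `ε = (k log k / T)^(1/3)`. -/
noncomputable def psimRate (k T : ℕ) : ℝ := (k * Real.log k / T) ^ (1 / 3 : ℝ)

/-- PSim with the above choice of the parameters. -/
noncomputable def tunedPSim (k T : ℕ) [NeZero k] : AllocationRule k T :=
  psim k T (psimPhases k T) (psimRate k T)
    ((Nat.mul_le_mul_right k (min_le_right _ _)).trans (Nat.div_mul_le_self T k))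

/-!
The exploration rounds do not depend on the bids, and raising a bid raises the relative gain
`ρ i t * b i / max b` of that agent and lowers those of the others.  Hence, for fixed exploration
rounds, the probability of being drawn in an exploitation round is monotone in one's own bid, and
charging Myerson's price per click is truthful.  As this price is computed from explored clicks
only, it is observable, and charging for exploration clicks is unnecessary.

For the regret, the weights are those of Hedge run on the gains of the exploration rounds, one step
per phase.  The distribution used in a phase is independent of the exploration rounds of that phase,
so the expected gain of Hedge in a phase is `1 / Q` times its expected gain over all rounds of the
phase.  This multiplies the regret `ε P + log k / ε` of Hedge by `Q`; exploration itself costs at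
most `P k` and the leftover rounds at most `T - P Q`.
-/

open Finset
open scoped BigOperators

/-! ### Hedge -/

theorem sub_sq_le_log_one_add {ε : ℝ} (hε : 0 ≤ ε) : ε - ε ^ 2 ≤ Real.log (1 + ε) := by
  refine le_trans ?_ (Real.le_log_one_add_of_nonneg hε)
  rw [le_div_iff₀ (by linarith)]
  nlinarith [pow_nonneg hε 2, pow_nonneg hε 3]

section Hedge

variable {ι : Type*} [Fintype ι] {c : ℝ} {G G' : ι → ℝ}

/-- The distribution over the experts `ι` played by the Hedge (multiplicative weights) algorithm
with base `c` when their gains so far add up to `G`: proportional to `c ^ G i`. -/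
noncomputable def hedge (c : ℝ) (G : ι → ℝ) (i : ι) : ℝ := c ^ G i / ∑ j, c ^ G j

theorem sum_rpow_pos [Nonempty ι] (hc : 0 < c) (G : ι → ℝ) : 0 < ∑ i, c ^ G i :=
  sum_pos (fun _ _ => Real.rpow_pos_of_pos hc _) univ_nonempty

theorem hedge_pos (hc : 0 < c) (G : ι → ℝ) (i : ι) : 0 < hedge c G i :=
  haveI : Nonempty ι := ⟨i⟩
  div_pos (Real.rpow_pos_of_pos hc _) (sum_rpow_pos hc G)

theorem sum_hedge [Nonempty ι] (hc : 0 < c) (G : ι → ℝ) : ∑ i, hedge c G i = 1 := by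
  simp only [hedge, ← sum_div, div_self (sum_rpow_pos hc G).ne']

theorem hedge_le_hedge (hc : 1 ≤ c) {i : ι} (hi : G i ≤ G' i) (hG : ∀ j ≠ i, G' j ≤ G j) :
    hedge c G i ≤ hedge c G' i := by
  have : Nonempty ι := ⟨i⟩
  have hc0 : 0 < c := one_pos.trans_le hc
  rw [hedge, hedge, div_le_div_iff₀ (sum_rpow_pos hc0 G) (sum_rpow_pos hc0 G'), mul_sum, mul_sum]
  refine sum_le_sum fun j _ => ?_
  rw [← Real.rpow_add hc0, ← Real.rpow_add hc0]
  refine Real.rpow_le_rpow_of_exponent_le hc ?_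
  obtain rfl | hj := eq_or_ne j i
  · rw [add_comm]
  · exact add_le_add hi (hG j hj)

variable [Nonempty ι] {ε : ℝ}

theorem log_sum_rpow_add_le (hε : 0 ≤ ε) (G : ι → ℝ) {x : ι → ℝ} (hx : ∀ i, x i ∈ Set.Icc 0 1) :
    Real.log (∑ i, (1 + ε) ^ (G i + x i)) ≤
      Real.log (∑ i, (1 + ε) ^ G i) + ε * ∑ i, hedge (1 + ε) G i * x i := by
  have hc : 0 < 1 + ε := by positivity
  set W := ∑ i, (1 + ε) ^ G i with hW
  have hWpos : 0 < W := sum_rpow_pos hc G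
  have hmean : 0 ≤ ∑ i, hedge (1 + ε) G i * x i :=
    sum_nonneg fun i _ => mul_nonneg (hedge_pos hc G i).le (hx i).1
  have hbernoulli : ∑ i, (1 + ε) ^ (G i + x i) ≤ W * (1 + ε * ∑ i, hedge (1 + ε) G i * x i) :=
    calc ∑ i, (1 + ε) ^ (G i + x i) ≤ ∑ i, (1 + ε) ^ G i * (1 + x i * ε) := by
          refine sum_le_sum fun i _ => ?_
          rw [Real.rpow_add hc]
          gcongr
          exact rpow_one_add_le_one_add_mul_self (by linarith) (hx i).1 (hx i).2
      _ = W * (1 + ε * ∑ i, hedge (1 + ε) G i * x i) := by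
          simp only [hedge, mul_add, mul_one, sum_add_distrib, mul_sum, ← hW]
          congr 1
          refine sum_congr rfl fun i _ => ?_
          field_simp
  calc Real.log (∑ i, (1 + ε) ^ (G i + x i))
      ≤ Real.log (W * (1 + ε * ∑ i, hedge (1 + ε) G i * x i)) :=
        Real.log_le_log (sum_rpow_pos hc _) hbernoulli
    _ = Real.log W + Real.log (1 + ε * ∑ i, hedge (1 + ε) G i * x i) :=
        Real.log_mul hWpos.ne' (by positivity)
    _ ≤ Real.log W + ε * ∑ i, hedge (1 + ε) G i * x i := by
        gcongr
        rw [add_comm]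
        exact (Real.log_le_sub_one_of_pos (by positivity)).trans_eq (add_sub_cancel_right _ _)

variable {κ : Type*} [LinearOrder κ] {x : κ → ι → ℝ}

theorem log_sum_rpow_sum_le (hε : 0 ≤ ε) (hx : ∀ m i, x m i ∈ Set.Icc 0 1) (s : Finset κ) :
    Real.log (∑ i, (1 + ε) ^ ∑ m ∈ s, x m i) ≤ Real.log (Fintype.card ι) +
      ε * ∑ m ∈ s, ∑ i, hedge (1 + ε) (fun j => ∑ l ∈ s with l < m, x l j) i * x m i := by
  induction s using induction_on_max with
  | empty => simp
  | insert a s ha ih =>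
    have has : a ∉ s := fun h => lt_irrefl a (ha a h)
    have hlast : {l ∈ insert a s | l < a} = s := by
      rw [filter_insert, if_neg (lt_irrefl a), filter_true_of_mem ha]
    have hbefore : ∑ m ∈ s, ∑ i, hedge (1 + ε) (fun j => ∑ l ∈ insert a s with l < m, x l j) i *
        x m i = ∑ m ∈ s, ∑ i, hedge (1 + ε) (fun j => ∑ l ∈ s with l < m, x l j) i * x m i :=
      sum_congr rfl fun m hm => by rw [filter_insert, if_neg (ha m hm).not_gt]
    rw [sum_insert (f := fun m => ∑ i, _ * x m i) has, hbefore, hlast]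
    simp only [sum_insert has, add_comm (x a _)]
    linarith [log_sum_rpow_add_le hε (fun i => ∑ m ∈ s, x m i) (hx a)]

omit [Nonempty ι] in
theorem sum_le_sum_hedge_add (hε : 0 < ε) (hx : ∀ m i, x m i ∈ Set.Icc 0 1) (s : Finset κ) (i : ι) :
    ∑ m ∈ s, x m i ≤
      ∑ m ∈ s, ∑ j, hedge (1 + ε) (fun j => ∑ l ∈ s with l < m, x l j) j * x m j +
        (ε * #s + Real.log (Fintype.card ι) / ε) := by
  have : Nonempty ι := ⟨i⟩
  have hc : 0 < 1 + ε := by positivity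
  set X := ∑ m ∈ s, x m i
  set Y := ∑ m ∈ s, ∑ j, hedge (1 + ε) (fun j => ∑ l ∈ s with l < m, x l j) j * x m j
  have hX0 : 0 ≤ X := sum_nonneg fun m _ => (hx m i).1
  have hXs : X ≤ #s := by
    simpa using sum_le_card_nsmul s (x · i) 1 fun m _ => (hx m i).2
  have hpotential : Real.log (1 + ε) * X ≤ Real.log (Fintype.card ι) + ε * Y := by
    refine le_trans ?_ (log_sum_rpow_sum_le hε.le hx s)
    rw [mul_comm, ← Real.log_rpow hc]
    exact Real.log_le_log (Real.rpow_pos_of_pos hc _) (single_le_sum (f := fun j =>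
      (1 + ε) ^ ∑ m ∈ s, x m j) (fun j _ => (Real.rpow_pos_of_pos hc _).le) (mem_univ i))
  refine le_of_mul_le_mul_left ?_ hε
  calc ε * X = (ε - ε ^ 2) * X + ε ^ 2 * X := by ring
    _ ≤ Real.log (1 + ε) * X + ε ^ 2 * #s := by
        gcongr
        exact sub_sq_le_log_one_add hε.le
    _ ≤ Real.log (Fintype.card ι) + ε * Y + ε ^ 2 * #s := by gcongr
    _ = ε * (Y + (ε * #s + Real.log (Fintype.card ι) / ε)) := by
        field_simp
        ring

end Hedge

/-! ### Myerson's price -/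

section Myerson

variable {q : ℝ → ℝ} {x y : ℝ}

theorem sub_mul_le_integral_of_monotoneOn (hq : MonotoneOn q (Set.uIcc y x)) :
    (x - y) * q y ≤ ∫ z in y..x, q z := by
  have hint : IntervalIntegrable q volume y x := hq.intervalIntegrable
  rw [← smul_eq_mul, ← intervalIntegral.integral_const]
  rcases le_total y x with h | h
  · exact intervalIntegral.integral_mono_on h intervalIntegrable_const hint fun z hz =>
      hq Set.left_mem_uIcc (Set.uIcc_of_le h ▸ hz) hz.1
  · rw [intervalIntegral.integral_symm x, intervalIntegral.integral_symm x, neg_le_neg_iff]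
    exact intervalIntegral.integral_mono_on h hint.symm intervalIntegrable_const fun z hz =>
      hq (Set.uIcc_of_ge h ▸ hz) Set.left_mem_uIcc hz.2

/-- Myerson's price for one unit of a good that a bid `z` obtains with probability `q z`, when the
bid is `y`.  Charging it only when the good is obtained makes the expected payment
`y * q y - ∫ z in 0..y, q z`. -/
noncomputable def myersonPrice (q : ℝ → ℝ) (y : ℝ) : ℝ := y - (∫ z in (0 : ℝ)..y, q z) / q y

theorem mul_sub_myersonPrice (hqy : q y ≠ 0) (x : ℝ) :
    q y * (x - myersonPrice q y) = (∫ z in (0 : ℝ)..y, q z) + (x - y) * q y := by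
  unfold myersonPrice
  field_simp
  ring

variable (hq : MonotoneOn q (Set.Ici 0)) (hpos : ∀ z, 0 ≤ z → 0 < q z)

include hpos in
theorem myersonPrice_le (hy : 0 ≤ y) : myersonPrice q y ≤ y :=
  sub_le_self _ <| div_nonneg
    (intervalIntegral.integral_nonneg hy fun z hz => (hpos z hz.1).le) (hpos y hy).le

include hq hpos

theorem mul_sub_myersonPrice_le (hx : 0 ≤ x) (hy : 0 ≤ y) :
    q y * (x - myersonPrice q y) ≤ q x * (x - myersonPrice q x) := by
  have hint : ∀ {a b : ℝ}, 0 ≤ a → 0 ≤ b → IntervalIntegrable q volume a b := fun ha hb =>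
    (hq.mono (Set.ordConnected_Ici.uIcc_subset ha hb)).intervalIntegrable
  rw [mul_sub_myersonPrice (hpos y hy).ne', mul_sub_myersonPrice (hpos x hx).ne', sub_self,
    zero_mul, add_zero, ← intervalIntegral.integral_add_adjacent_intervals
      (hint le_rfl hy) (hint hy hx)]
  gcongr
  exact sub_mul_le_integral_of_monotoneOn (hq.mono (Set.ordConnected_Ici.uIcc_subset hy hx))

theorem myersonPrice_nonneg (hy : 0 ≤ y) : 0 ≤ myersonPrice q y := by
  have h := mul_sub_myersonPrice_le hq hpos le_rfl hy
  have h0 : q 0 * (0 - myersonPrice q 0) = 0 := by simp [myersonPrice]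
  rw [h0, zero_sub, mul_neg, neg_nonpos] at h
  exact nonneg_of_mul_nonneg_right h (hpos y hy)

end Myerson

/-! ### Sampling -/

theorem integral_comp_eq_sum_measureReal {Ω α : Type*} [MeasurableSpace Ω] {μ : Measure Ω}
    [IsFiniteMeasure μ] [Fintype α] [MeasurableSpace α] [MeasurableSingletonClass α] {X : Ω → α}
    (hX : Measurable X) (F : α → ℝ) :
    ∫ ω, F (X ω) ∂μ = ∑ a, μ.real {ω | X ω = a} * F a := by
  rw [← integral_map hX.aemeasurable (measurable_of_finite F).aestronglyMeasurable,
    integral_fintype Integrable.of_finite]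
  refine sum_congr rfl fun a _ => ?_
  rw [map_measureReal_apply hX (measurableSet_singleton a), smul_eq_mul]
  rfl

section Sample

variable {k : ℕ} [NeZero k] {γ : Fin k → ℝ} (hγ : ∀ i, 0 ≤ γ i)

include hγ

theorem sample_eq_iff {u : ℝ} (hu0 : 0 ≤ u) (hu : u < ∑ i, γ i) (i : Fin k) :
    sample γ u = i ↔ u ∈ Set.Ico (∑ j ∈ Iio i, γ j) (∑ j ∈ Iic i, γ j) := by
  classical
  have hmono {s t : Finset (Fin k)} (hst : s ⊆ t) : ∑ j ∈ s, γ j ≤ ∑ j ∈ t, γ j :=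
    sum_le_sum_of_subset_of_nonneg hst fun j _ _ => hγ j
  have hne : (univ.filter fun i => u < ∑ j ∈ Iic i, γ j).Nonempty := ⟨⊤, by simpa using hu⟩
  have hmin : sample γ u = (univ.filter fun i => u < ∑ j ∈ Iic i, γ j).min' hne := by
    rw [sample, firstAgent]
    convert dif_pos hne
  simp only [hmin, min'_eq_iff, mem_filter, mem_univ, true_and, Set.mem_Ico]
  refine ⟨fun ⟨hi, hfirst⟩ => ⟨?_, hi⟩, fun ⟨hlow, hi⟩ => ⟨hi, fun j hj => ?_⟩⟩
  · obtain hempty | hIio := (Iio i).eq_empty_or_nonempty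
    · simpa [hempty] using hu0
    · by_contra! hlt
      refine (mem_Iio.1 (max'_mem _ hIio)).not_ge (hfirst _ (hlt.trans_le (hmono fun j hj => ?_)))
      exact mem_Iic.2 (le_max' _ _ hj)
  · by_contra! hji
    exact (hj.trans_le (hmono fun l hl => mem_Iio.2 ((mem_Iic.1 hl).trans_lt hji))).not_ge hlow

variable (hγ1 : ∑ i, γ i = 1)

include hγ1

theorem volume_real_sample_eq (i : Fin k) :
    (volume : Measure unitInterval).real {u | sample γ u = i} = γ i := by
  have hsucc : ∑ j ∈ Iic i, γ j = γ i + ∑ j ∈ Iio i, γ j := by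
    rw [← Iio_insert, sum_insert (by simp)]
  have hlow : 0 ≤ ∑ j ∈ Iio i, γ j := sum_nonneg fun j _ => hγ j
  have hhigh : ∑ j ∈ Iic i, γ j ≤ 1 :=
    hγ1 ▸ sum_le_sum_of_subset_of_nonneg (subset_univ _) fun j _ _ => hγ j
  have hae : {u : unitInterval | sample γ u = i} =ᵐ[volume]
      ((↑) : unitInterval → ℝ) ⁻¹' Set.Ico (∑ j ∈ Iio i, γ j) (∑ j ∈ Iic i, γ j) := by
    have hne : ∀ᵐ u : unitInterval, u ≠ 1 := by simp [ae_iff]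
    filter_upwards [hne] with u hu
    exact propext (sample_eq_iff hγ u.2.1 (hγ1 ▸ unitInterval.lt_one_iff_ne_one.2 hu) i)
  rw [measureReal_congr hae, measureReal_def,
    unitInterval.measurePreserving_coe.measure_preimage measurableSet_Ico.nullMeasurableSet,
    Measure.restrict_apply measurableSet_Ico,
    Set.inter_eq_left.2 (Set.Ico_subset_Icc_self.trans (Set.Icc_subset_Icc hlow hhigh)),
    Real.volume_Ico, hsucc, add_sub_cancel_right, ENNReal.toReal_ofReal (hγ i)]

theorem integral_comp_sample (F : Fin k → ℝ) :
    ∫ u : unitInterval, F (sample γ u) = ∑ i, γ i * F i := by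
  rw [integral_comp_eq_sum_measureReal (X := fun u : unitInterval => sample γ u)
    ((measurable_sample γ).comp measurable_subtype_coe)]
  simp only [volume_real_sample_eq hγ hγ1]

end Sample

/-! ### Bids and relative gains -/

theorem update_nonneg {ι : Type*} [DecidableEq ι] {b : ι → ℝ} {x : ℝ} (hb : ∀ i, 0 ≤ b i)
    (hx : 0 ≤ x) (i j : ι) : 0 ≤ Function.update b i x j :=
  (le_update_iff (x := fun _ => 0)).2 ⟨hx, fun j _ => hb j⟩ j

section Bids

variable {ι : Type*} [Fintype ι] [Nonempty ι] {b : ι → ℝ}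

/-- The largest bid `max b`. -/
noncomputable def maxBid (b : ι → ℝ) : ℝ := univ.sup' univ_nonempty b

theorem le_maxBid (b : ι → ℝ) (i : ι) : b i ≤ maxBid b := le_sup' b (mem_univ i)

theorem maxBid_le {c : ℝ} (h : ∀ i, b i ≤ c) : maxBid b ≤ c := sup'_le _ _ fun i _ => h i

theorem maxBid_nonneg (hb : ∀ i, 0 ≤ b i) : 0 ≤ maxBid b :=
  (hb (Classical.arbitrary ι)).trans (le_maxBid b _)

variable [DecidableEq ι] {i j : ι} {x y : ℝ}

theorem le_maxBid_update_self (b : ι → ℝ) (i : ι) (x : ℝ) : x ≤ maxBid (Function.update b i x) := by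
  simpa using le_maxBid (Function.update b i x) i

theorem le_maxBid_update (hj : j ≠ i) (b : ι → ℝ) (x : ℝ) :
    b j ≤ maxBid (Function.update b i x) := by
  simpa [hj] using le_maxBid (Function.update b i x) j

theorem maxBid_update_mono (b : ι → ℝ) (i : ι) : Monotone fun x => maxBid (Function.update b i x) :=
  fun x y hxy => maxBid_le fun j => by
    obtain rfl | hj := eq_or_ne j i
    · simpa using hxy.trans (le_maxBid_update_self b j y)
    · simpa [hj] using le_maxBid_update hj b y

theorem div_maxBid_update_le_self (hx : 0 ≤ x) (hxy : x ≤ y) :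
    x / maxBid (Function.update b i x) ≤ y / maxBid (Function.update b i y) := by
  have hxM := le_maxBid_update_self b i x
  have hyM := le_maxBid_update_self b i y
  obtain rfl | hx0 := hx.eq_or_lt
  · simpa using div_nonneg hxy (hxy.trans hyM)
  rw [div_le_div_iff₀ (hx0.trans_le hxM) (hx0.trans_le (hxy.trans hyM)), ← le_div_iff₀' hx0]
  refine maxBid_le fun j => (le_div_iff₀' hx0).2 ?_
  obtain rfl | hj := eq_or_ne j i
  · rw [Function.update_self, mul_comm]
    exact mul_le_mul_of_nonneg_left hxM (hx.trans hxy)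
  · rw [Function.update_of_ne hj]
    exact (mul_le_mul_of_nonneg_left (le_maxBid_update hj b x) hx).trans
      (mul_le_mul_of_nonneg_right hxy (hx.trans hxM))

theorem div_maxBid_update_anti (hb : ∀ i, 0 ≤ b i) (hx : 0 ≤ x) (hxy : x ≤ y) (hj : j ≠ i) :
    b j / maxBid (Function.update b i y) ≤ b j / maxBid (Function.update b i x) := by
  obtain hM | hM := (maxBid_nonneg (update_nonneg hb hx i)).eq_or_lt
  · rw [((le_maxBid_update hj b x).trans hM.ge).antisymm (hb j), zero_div, zero_div]
  · exact div_le_div_of_nonneg_left (hb j) hM (maxBid_update_mono b i hxy)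

end Bids

section RelGain

variable {k T : ℕ} {b : Fin k → ℝ} (ρ : Realization k T) {i : Fin k} {t : Fin T}

theorem click_nonneg : 0 ≤ click ρ i t := by
  unfold click
  split_ifs <;> norm_num

theorem click_le_one : click ρ i t ≤ 1 := by
  unfold click
  split_ifs <;> norm_num

variable [NeZero k]

/-- The gain `ρ i t * b i / max b` of playing agent `i` at round `t`, relative to the largest
bid. -/
noncomputable def relGain (b : Fin k → ℝ) (ρ : Realization k T) (i : Fin k) (t : Fin T) : ℝ :=
  click ρ i t * b i / maxBid b

theorem maxBid_mul_relGain (hb : ∀ j, 0 ≤ b j) :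
    maxBid b * relGain b ρ i t = b i * click ρ i t := by
  rw [relGain]
  obtain hM | hM := (maxBid_nonneg hb).eq_or_lt
  · rw [((le_maxBid b i).trans hM.ge).antisymm (hb i), ← hM, zero_mul, zero_mul]
  · rw [mul_div_cancel₀ _ hM.ne', mul_comm]

theorem relGain_mem_Icc (hb : ∀ j, 0 ≤ b j) : relGain b ρ i t ∈ Set.Icc 0 1 := by
  refine ⟨div_nonneg (mul_nonneg (click_nonneg ρ) (hb i)) (maxBid_nonneg hb),
    div_le_one_of_le₀ ?_ (maxBid_nonneg hb)⟩
  exact (mul_le_of_le_one_left (hb i) (click_le_one ρ)).trans (le_maxBid b i)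

variable {x y : ℝ}

theorem relGain_update_le_self (hx : 0 ≤ x) (hxy : x ≤ y) :
    relGain (Function.update b i x) ρ i t ≤ relGain (Function.update b i y) ρ i t := by
  simp only [relGain, Function.update_self, mul_div_assoc]
  exact mul_le_mul_of_nonneg_left (div_maxBid_update_le_self hx hxy) (click_nonneg ρ)

theorem relGain_update_anti (hb : ∀ j, 0 ≤ b j) (hx : 0 ≤ x) (hxy : x ≤ y) {j : Fin k}
    (hj : j ≠ i) :
    relGain (Function.update b i y) ρ j t ≤ relGain (Function.update b i x) ρ j t := by
  simp only [relGain, Function.update_of_ne hj, mul_div_assoc]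
  exact mul_le_mul_of_nonneg_left (div_maxBid_update_anti hb hx hxy hj) (click_nonneg ρ)

end RelGain

/-! ### The exploitation distribution -/

namespace Exploration

variable {k P Q T : ℕ} (hT : P * Q ≤ T) (e : Exploration k P Q)

/-- Whether `t` is an exploration round. -/
def IsExplored (t : Fin T) : Prop := ∃ i, ∃ p, e.round hT p i = t

variable [NeZero k] {ε : ℝ} {b : Fin k → ℝ} (ρ : Realization k T)

/-- The total relative gain of agent `i` in her exploration rounds of the first `m` phases. -/
noncomputable def exploredGain (b : Fin k → ℝ) (ρ : Realization k T) (m : ℕ) (i : Fin k) : ℝ :=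
  ∑ p ∈ univ.filter fun p : Fin P => (p : ℕ) < m, relGain b ρ i (e.round hT p i)

theorem exploredGain_congr {e e' : Exploration k P Q} (b : Fin k → ℝ) {m : ℕ}
    (h : ∀ p : Fin P, (p : ℕ) < m → e p = e' p) :
    e.exploredGain hT b ρ m = e'.exploredGain hT b ρ m :=
  funext fun i => sum_congr rfl fun p hp => by simp only [round, h p (mem_filter.1 hp).2]

theorem exploredGain_succ (b : Fin k → ℝ) {m : ℕ} (hm : m < P) (i : Fin k) :
    e.exploredGain hT b ρ (m + 1) i =
      e.exploredGain hT b ρ m i + relGain b ρ i (e.round hT ⟨m, hm⟩ i) := by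
  have hfilter : univ.filter (fun p : Fin P => (p : ℕ) < m + 1) =
      insert ⟨m, hm⟩ (univ.filter fun p : Fin P => (p : ℕ) < m) := by
    ext p
    simp only [mem_filter, mem_univ, true_and, mem_insert, Fin.ext_iff]
    omega
  rw [exploredGain, hfilter, sum_insert (by simp), add_comm, exploredGain]

theorem exploredGain_succ_of_le (b : Fin k → ℝ) {m : ℕ} (hm : P ≤ m) (i : Fin k) :
    e.exploredGain hT b ρ (m + 1) i = e.exploredGain hT b ρ m i := by
  rw [exploredGain, exploredGain]
  congr 1
  ext p
  have := p.isLt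
  simp only [mem_filter, mem_univ, true_and]
  omega

variable (hε : 0 ≤ ε)

include hε

theorem weight_eq_rpow (b : Fin k → ℝ) (m : ℕ) (i : Fin k) :
    e.weight hT ε b ρ m i = (1 + ε) ^ e.exploredGain hT b ρ m i := by
  induction m with
  | zero => simp [weight, exploredGain]
  | succ m ih =>
    rw [weight]
    split_ifs with hm
    · rw [e.exploredGain_succ hT ρ b hm, Real.rpow_add (by positivity), ih, relGain, maxBid]
    · rw [e.exploredGain_succ_of_le hT ρ b (not_lt.1 hm), ih]

theorem dist_eq_hedge (b : Fin k → ℝ) (t : Fin T) :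
    e.dist hT ε b ρ t = hedge (1 + ε) (e.exploredGain hT b ρ (t / Q)) := by
  funext i
  simp only [dist, hedge, e.weight_eq_rpow hT ρ hε]

theorem dist_pos (b : Fin k → ℝ) (t : Fin T) (i : Fin k) : 0 < e.dist hT ε b ρ t i := by
  rw [e.dist_eq_hedge hT ρ hε]
  exact hedge_pos (by positivity) _ i

theorem sum_dist (b : Fin k → ℝ) (t : Fin T) : ∑ i, e.dist hT ε b ρ t i = 1 := by
  rw [e.dist_eq_hedge hT ρ hε]
  exact sum_hedge (by positivity) _

theorem monotoneOn_dist_update (hb : ∀ j, 0 ≤ b j) (t : Fin T) (i : Fin k) :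
    MonotoneOn (fun z => e.dist hT ε (Function.update b i z) ρ t i) (Set.Ici 0) := by
  intro x hx y _ hxy
  simp only [e.dist_eq_hedge hT ρ hε]
  exact hedge_le_hedge (by linarith)
    (sum_le_sum fun p _ => relGain_update_le_self ρ hx hxy)
    (fun j hj => sum_le_sum fun p _ => relGain_update_anti ρ hb hx hxy hj)

end Exploration

/-! ### The distribution of the agents played by PSim -/

section Outcome

variable {k P Q T : ℕ} [NeZero k] (hT : P * Q ≤ T) (ε : ℝ) (b : Fin k → ℝ) (ρ : Realization k T)

theorem psimAlloc_of_not_isExplored {e : Exploration k P Q} {t : Fin T}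
    (h : ¬ e.IsExplored hT t) (u : Fin T → unitInterval) :
    psimAlloc hT ε e u b ρ t = sample (e.dist hT ε b ρ t) (u t) :=
  dif_neg h

variable {ε} in
theorem integral_psimAlloc_of_not_isExplored (hε : 0 ≤ ε) {e : Exploration k P Q} {t : Fin T}
    (h : ¬ e.IsExplored hT t) (F : Fin k → ℝ) :
    ∫ u, F (psimAlloc hT ε e u b ρ t) = ∑ i, e.dist hT ε b ρ t i * F i := by
  have hsample : Measurable fun u : unitInterval => sample (e.dist hT ε b ρ t) u :=
    (measurable_sample _).comp measurable_subtype_coe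
  simp only [psimAlloc_of_not_isExplored hT ε b ρ h]
  rw [← integral_comp_sample (fun i => (e.dist_pos hT ρ hε b t i).le) (e.sum_dist hT ρ hε b t)]
  exact integral_comp_eval (ι := Fin T) (X := fun _ => unitInterval)
    (f := fun u : unitInterval => F (sample (e.dist hT ε b ρ t) u))
    ((measurable_of_finite F).comp hsample).aestronglyMeasurable

theorem measurable_psimOutcome :
    Measurable fun ω : Exploration k P Q × (Fin T → unitInterval) =>
      (ω.1, psimAlloc hT ε ω.1 ω.2 b ρ) :=
  measurable_fst.prodMk (measurable_pi_lambda _ (measurable_psimAlloc hT ε b ρ))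

end Outcome

theorem Exploration.nonempty_of_mul_le {k T P : ℕ} (hP : P * k ≤ T) :
    Nonempty (Exploration k P (T / P)) :=
  nonempty_of_le fun h => (Nat.le_div_iff_mul_le h).2 (by rwa [mul_comm])

theorem integral_sum_psim_alloc {k T P : ℕ} [NeZero k] {ε : ℝ} (hP : P * k ≤ T) (b : Fin k → ℝ)
    (ρ : Realization k T) (F : Exploration k P (T / P) → Fin T → Fin k → ℝ) :
    ∫ ω, ∑ t, F ω.1 t ((psim k T P ε hP).alloc ω b ρ t) ∂(psim k T P ε hP).law =
      𝔼 e, ∑ t, ∫ u, F e t (psimAlloc (Nat.mul_div_le T P) ε e u b ρ t) := by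
  have := Exploration.nonempty_of_mul_le hP
  have hint (e : Exploration k P (T / P)) (t : Fin T) :
      Integrable fun u => F e t (psimAlloc (Nat.mul_div_le T P) ε e u b ρ t) :=
    Integrable.of_finite.comp_measurable
      ((measurable_psimAlloc (Nat.mul_div_le T P) ε b ρ t).comp measurable_prodMk_left)
  calc ∫ ω, ∑ t, F ω.1 t ((psim k T P ε hP).alloc ω b ρ t) ∂(psim k T P ε hP).law
      = ∫ e, (∫ u, ∑ t, F e t (psimAlloc (Nat.mul_div_le T P) ε e u b ρ t))
          ∂(PMF.uniformOfFintype (Exploration k P (T / P))).toMeasure :=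
        integral_prod _ <|
          (Integrable.of_finite (f := fun o : Exploration k P (T / P) × (Fin T → Fin k) =>
            ∑ t, F o.1 t (o.2 t))).comp_measurable
              (measurable_psimOutcome (Nat.mul_div_le T P) ε b ρ)
    _ = 𝔼 e, ∑ t, ∫ u, F e t (psimAlloc (Nat.mul_div_le T P) ε e u b ρ t) := by
        rw [PMF.integral_eq_sum, Fintype.expect_eq_sum_div_card, sum_div]
        refine sum_congr rfl fun e _ => ?_
        rw [integral_finsetSum _ fun t _ => hint e t, PMF.uniformOfFintype_apply,
          ENNReal.toReal_inv, ENNReal.toReal_natCast, smul_eq_mul, inv_mul_eq_div]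

/-! ### The payment rule -/

section RoundPrice

variable {k P Q T : ℕ} [NeZero k] (hT : P * Q ≤ T) (ε : ℝ)

open Classical in
/-- The price of a click of agent `i` at round `t`: nothing in an exploration round, where the
choice of the agent does not depend on the bids, and Myerson's price for the probability of being
drawn in an exploitation round. -/
noncomputable def roundPrice (e : Exploration k P Q) (b : Fin k → ℝ) (ρ : Realization k T)
    (t : Fin T) (i : Fin k) : ℝ :=
  if e.IsExplored hT t then 0
  else myersonPrice (fun z => e.dist hT ε (Function.update b i z) ρ t i) (b i)

variable {ε} (hε : 0 ≤ ε) (e : Exploration k P Q) {b : Fin k → ℝ} (hb : ∀ j, 0 ≤ b j)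
  (ρ : Realization k T) (t : Fin T) (i : Fin k)

include hε hb

theorem roundPrice_nonneg : 0 ≤ roundPrice hT ε e b ρ t i := by
  rw [roundPrice]
  split_ifs
  · exact le_rfl
  · exact myersonPrice_nonneg (e.monotoneOn_dist_update hT ρ hε hb t i)
      (fun _ _ => e.dist_pos hT ρ hε _ t i) (hb i)

theorem roundPrice_le : roundPrice hT ε e b ρ t i ≤ b i := by
  rw [roundPrice]
  split_ifs
  · exact hb i
  · exact myersonPrice_le (fun _ _ => e.dist_pos hT ρ hε _ t i) (hb i)

theorem integral_round_utility_le {x : ℝ} (hx : 0 ≤ x) :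
    ∫ u, (if psimAlloc hT ε e u b ρ t = i then
        click ρ i t * (x - roundPrice hT ε e b ρ t i) else 0) ≤
      ∫ u, if psimAlloc hT ε e u (Function.update b i x) ρ t = i then
        click ρ i t * (x - roundPrice hT ε e (Function.update b i x) ρ t i) else 0 := by
  by_cases h : e.IsExplored hT t
  · obtain ⟨j, p, rfl⟩ := id h
    simp only [roundPrice, h, if_true, psimAlloc_round, le_refl]
  · have hutility (b' : Fin k → ℝ) :
        ∫ u, (if psimAlloc hT ε e u b' ρ t = i then
          click ρ i t * (x - roundPrice hT ε e b' ρ t i) else 0) =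
        click ρ i t * (e.dist hT ε b' ρ t i * (x - roundPrice hT ε e b' ρ t i)) := by
      rw [integral_psimAlloc_of_not_isExplored hT b' ρ hε h fun j => if j = i then _ else 0]
      simp only [mul_ite, mul_zero, sum_ite_eq', mem_univ, if_true]
      ring
    have hmyerson := mul_sub_myersonPrice_le (e.monotoneOn_dist_update hT ρ hε hb t i)
      (fun _ _ => e.dist_pos hT ρ hε _ t i) hx (hb i)
    rw [hutility, hutility]
    refine mul_le_mul_of_nonneg_left ?_ (click_nonneg ρ)
    simpa only [roundPrice, h, if_false, Function.update_idem, Function.update_self,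
      Function.update_eq_self] using hmyerson

end RoundPrice

section Payment

theorem Exploration.dist_congr {k P Q T : ℕ} [NeZero k] (hT : P * Q ≤ T) (e : Exploration k P Q)
    (ε : ℝ) (b : Fin k → ℝ) {ρ ρ' : Realization k T}
    (h : ∀ p i, ρ i (e.round hT p i) = ρ' i (e.round hT p i)) :
    e.dist hT ε b ρ = e.dist hT ε b ρ' := by
  funext t i
  simp only [dist, e.weight_congr hT ε b ρ ρ' _ fun p i _ => h p i]

variable (k T P : ℕ) [NeZero k] (ε : ℝ) (hP : P * k ≤ T)

/-- The payment rule that charges the agent played at each round `roundPrice` per click. -/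
noncomputable def psimPayment : PaymentRule (psim k T P ε hP) where
  pay ω b ρ i := ∑ t, if psimAlloc (Nat.mul_div_le T P) ε ω.1 ω.2 b ρ t = i then
    click ρ i t * roundPrice (Nat.mul_div_le T P) ε ω.1 b ρ t i else 0
  measurable_pay b ρ i :=
    (measurable_of_finite fun o : Exploration k P (T / P) × (Fin T → Fin k) =>
      ∑ t, if o.2 t = i then
        click ρ i t * roundPrice (Nat.mul_div_le T P) ε o.1 b ρ t i else 0).comp
      (measurable_psimOutcome (Nat.mul_div_le T P) ε b ρ)
  observed := by
    rintro ⟨e, u⟩ b ρ ρ' h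
    have hT := Nat.mul_div_le T P
    change ∀ t, ρ (psimAlloc hT ε e u b ρ t) t = ρ' (psimAlloc hT ε e u b ρ t) t at h
    have hdist (b' : Fin k → ℝ) : e.dist hT ε b' ρ = e.dist hT ε b' ρ' :=
      e.dist_congr hT ε b' fun p i => by simpa only [psimAlloc_round] using h (e.round hT p i)
    refine funext fun i => sum_congr rfl fun t _ => ?_
    rw [← psimAlloc_online hT ε e u b ρ ρ' t fun s _ => h s]
    refine if_ctx_congr Iff.rfl (fun hi => ?_) fun _ => rfl
    have hclick : ρ i t = ρ' i t := by simpa only [hi] using h t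
    simp only [roundPrice, hdist, click, hclick]

variable {k T P ε hP}

theorem psimPayment_pay (ω : (psim k T P ε hP).Seed) (b : Fin k → ℝ) (ρ : Realization k T)
    (i : Fin k) : (psimPayment k T P ε hP).pay ω b ρ i =
      ∑ t, if (psim k T P ε hP).alloc ω b ρ t = i then
        click ρ i t * roundPrice (Nat.mul_div_le T P) ε ω.1 b ρ t i else 0 :=
  rfl

variable (hε : 0 ≤ ε)

include hε

theorem psimPayment_isNormalized : (psimPayment k T P ε hP).IsNormalized := by
  intro ω b hb ρ i
  have hT := Nat.mul_div_le T P
  rw [psimPayment_pay, AllocationRule.clicks, mul_sum]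
  refine ⟨sum_nonneg fun t _ => ?_, sum_le_sum fun t _ => ?_⟩ <;> split_ifs
  · exact mul_nonneg (click_nonneg ρ) (roundPrice_nonneg hT hε ω.1 hb ρ t i)
  · exact le_rfl
  · rw [mul_comm (b i)]
    exact mul_le_mul_of_nonneg_left (roundPrice_le hT hε ω.1 hb ρ t i) (click_nonneg ρ)
  · rw [mul_zero]

theorem psimPayment_isWeaklyTruthful : (psimPayment k T P ε hP).IsWeaklyTruthful := by
  intro ρ i x hx b hb
  have hT := Nat.mul_div_le T P
  have hutility (b' : Fin k → ℝ) : ∫ ω, (psimPayment k T P ε hP).utility ω x b' ρ i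
      ∂(psim k T P ε hP).law = 𝔼 e, ∑ t, ∫ u, if psimAlloc hT ε e u b' ρ t = i then
        click ρ i t * (x - roundPrice hT ε e b' ρ t i) else 0 := by
    rw [← integral_sum_psim_alloc hP b' ρ fun e t j => if j = i then
      click ρ i t * (x - roundPrice hT ε e b' ρ t i) else 0]
    congr with ω
    rw [PaymentRule.utility, AllocationRule.clicks, psimPayment_pay, mul_sum, ← sum_sub_distrib]
    refine sum_congr rfl fun t _ => ?_
    split_ifs <;> ring
  rw [hutility, hutility]
  exact expect_le_expect fun e _ => sum_le_sum fun t _ =>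
    integral_round_utility_le hT hε e hb ρ t i hx

end Payment

/-! ### Uniformly random exploration rounds -/

section Expect

variable {κ ι α : Type*} [Fintype κ] [Fintype ι] [Fintype α]

theorem expect_perm_apply [DecidableEq α] (h : α → ℝ) (a : α) :
    𝔼 σ : Equiv.Perm α, h (σ a) = 𝔼 b, h b := by
  have : Nonempty α := ⟨a⟩
  calc 𝔼 σ : Equiv.Perm α, h (σ a)
      = 𝔼 b, 𝔼 σ : Equiv.Perm α, h (σ b) := by
        rw [← Fintype.expect_const (ι := α) (𝔼 σ : Equiv.Perm α, h (σ a))]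
        refine expect_congr rfl fun b _ =>
          Fintype.expect_equiv (Equiv.mulRight (Equiv.swap a b)) _ _ fun σ => ?_
        simp
    _ = 𝔼 σ : Equiv.Perm α, 𝔼 b, h (σ b) := expect_comm _ _ _
    _ = 𝔼 b, h b := by
        rw [expect_congr rfl fun σ _ => Fintype.expect_equiv σ (fun b => h (σ b)) h fun _ => rfl,
          Fintype.expect_const]

theorem expect_mul_embedding_apply [DecidableEq κ] {p : κ} {f : (κ → ι ↪ α) → ℝ}
    (hf : DependsOn f {p}ᶜ) (i : ι) (h : α → ℝ) : 𝔼 e, f e * h (e p i) = (𝔼 e, f e) * 𝔼 a, h a := by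
  classical
  -- Permuting the values of `e p` preserves the uniform distribution of `e` and leaves `f e` fixed.
  have hperm (σ : Equiv.Perm α) : 𝔼 e, f e * h (e p i) = 𝔼 e, f e * h (σ (e p i)) := by
    let permute : (κ → ι ↪ α) ≃ (κ → ι ↪ α) := Equiv.piCongrRight
      (Function.update (fun _ => Equiv.refl _) p (Equiv.embeddingCongr (Equiv.refl ι) σ))
    refine (Fintype.expect_equiv permute _ _ fun e => ?_).symm
    have hother : f (permute e) = f e := hf fun q hq => by
      simp [permute, Function.update_of_ne hq]
    simp [hother, permute]
  calc 𝔼 e, f e * h (e p i)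
      = 𝔼 σ : Equiv.Perm α, 𝔼 e, f e * h (σ (e p i)) := by
        rw [← expect_congr rfl fun σ _ => hperm σ, Fintype.expect_const]
    _ = 𝔼 e, f e * 𝔼 σ : Equiv.Perm α, h (σ (e p i)) := by
        rw [expect_comm]
        simp only [mul_expect]
    _ = (𝔼 e, f e) * 𝔼 a, h a := by
        simp only [expect_perm_apply, expect_mul]

end Expect

section PhaseRound

variable {P Q T : ℕ} (hT : P * Q ≤ T)

/-- The round at position `x.2` of phase `x.1`. -/
def phaseRound (x : Fin P × Fin Q) : Fin T := Fin.castLE hT (finProdFinEquiv x)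

theorem phaseRound_injective : Function.Injective (phaseRound hT) :=
  (Fin.castLE_injective hT).comp finProdFinEquiv.injective

theorem phaseRound_div (x : Fin P × Fin Q) : (phaseRound hT x : ℕ) / Q = x.1 :=
  congrArg Fin.val (congrArg Prod.fst (finProdFinEquiv.symm_apply_apply x))

theorem Exploration.round_eq_phaseRound {k : ℕ} (e : Exploration k P Q) (p : Fin P) (i : Fin k) :
    e.round hT p i = phaseRound hT (p, e p i) :=
  Fin.ext (by simp [round, phaseRound, add_comm, mul_comm])

variable {f : Fin T → ℝ}

theorem sum_phaseRound_le (hf : ∀ t, 0 ≤ f t) : ∑ x, f (phaseRound hT x) ≤ ∑ t, f t := by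
  rw [← sum_image (phaseRound_injective hT).injOn]
  exact sum_le_univ_sum_of_nonneg hf

theorem sum_le_sum_phaseRound_add (hf : ∀ t, f t ≤ 1) :
    ∑ t, f t ≤ ∑ x, f (phaseRound hT x) + (T - P * Q) := by
  have h := sum_phaseRound_le hT (f := fun t => 1 - f t) fun t => sub_nonneg.2 (hf t)
  simp only [sum_sub_distrib, sum_const, card_univ, Fintype.card_prod, Fintype.card_fin,
    nsmul_eq_mul, mul_one, Nat.cast_mul] at h
  linarith

end PhaseRound

namespace Exploration

variable {k P Q T : ℕ} (hT : P * Q ≤ T)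

open Classical in
theorem card_isExplored_le (e : Exploration k P Q) : #{t | e.IsExplored hT t} ≤ P * k := by
  have himage : univ.filter (e.IsExplored hT) =
      univ.image fun x : Fin P × Fin k => e.round hT x.1 x.2 := by
    ext t
    simp [IsExplored, Prod.exists, exists_comm (α := Fin k)]
  rw [himage]
  exact card_image_le.trans_eq (by simp)

theorem expect_sum_mul_round {c : Exploration k P Q → Fin P → ℝ}
    (hc : ∀ p, DependsOn (fun e => c e p) {p}ᶜ) (f : Fin T → ℝ) (i : Fin k) :
    Q * 𝔼 e : Exploration k P Q, ∑ p, c e p * f (e.round hT p i) =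
      𝔼 e, ∑ x : Fin P × Fin Q, c e x.1 * f (phaseRound hT x) := by
  have hphase (p : Fin P) : Q * 𝔼 e : Exploration k P Q, c e p * f (e.round hT p i) =
      𝔼 e, c e p * ∑ q, f (phaseRound hT (p, q)) := by
    have hindep : 𝔼 e : Exploration k P Q, c e p * f (phaseRound hT (p, e p i)) =
        (𝔼 e, c e p) * 𝔼 q, f (phaseRound hT (p, q)) :=
      expect_mul_embedding_apply (hc p) i fun q => f (phaseRound hT (p, q))
    have hcard : (Q : ℝ) * 𝔼 q, f (phaseRound hT (p, q)) = ∑ q, f (phaseRound hT (p, q)) := by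
      simpa using Fintype.card_mul_expect fun q => f (phaseRound hT (p, q))
    simp only [round_eq_phaseRound, hindep, ← expect_mul, ← hcard]
    ring
  simp only [expect_sum_comm, mul_sum, Fintype.sum_prod_type, hphase]

end Exploration

/-! ### The regret of PSim -/

namespace AllocationRule

variable {k T : ℕ} (A : AllocationRule k T) {b : Fin k → ℝ} (ρ : Realization k T)

theorem sum_mul_playProb (b : Fin k → ℝ) (t : Fin T) (F : Fin k → ℝ) :
    ∑ i, F i * A.playProb b ρ t i = ∫ ω, F (A.alloc ω b ρ t) ∂A.law := by
  rw [integral_comp_eq_sum_measureReal (A.measurable_alloc b ρ t)]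
  exact sum_congr rfl fun i _ => mul_comm _ _

variable [NeZero k] (hb : ∀ j, 0 ≤ b j)

include hb

theorem regret_le_of_forall {c : ℝ} (h : ∀ i, ∑ t, relGain b ρ i t ≤
    ∫ ω, ∑ t, relGain b ρ (A.alloc ω b ρ t) t ∂A.law + c) : A.regret b ρ ≤ maxBid b * c := by
  have hint (t : Fin T) : Integrable (fun ω => relGain b ρ (A.alloc ω b ρ t) t) A.law :=
    (Integrable.of_finite (f := fun i => relGain b ρ i t)).comp_measurable
      (A.measurable_alloc b ρ t)
  have hwelfare : ∑ t, ∑ i, b i * click ρ i t * A.playProb b ρ t i =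
      maxBid b * ∫ ω, ∑ t, relGain b ρ (A.alloc ω b ρ t) t ∂A.law := by
    simp only [A.sum_mul_playProb ρ b, ← maxBid_mul_relGain ρ hb, integral_const_mul, ← mul_sum]
    rw [integral_finsetSum _ fun t _ => hint t]
  rw [regret, hwelfare, sub_le_iff_le_add', ← mul_add]
  refine sup'_le _ _ fun i _ => ?_
  simp only [mul_sum, ← maxBid_mul_relGain ρ hb]
  rw [← mul_sum]
  exact mul_le_mul_of_nonneg_left (h i) (maxBid_nonneg hb)

theorem regret_nonpos_of_subsingleton [Subsingleton (Fin k)] : A.regret b ρ ≤ 0 := by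
  refine (A.regret_le_of_forall ρ hb (c := 0) fun i => ?_).trans_eq (mul_zero _)
  simp [Subsingleton.elim _ i]

theorem regret_le_maxBid_mul : A.regret b ρ ≤ maxBid b * T := by
  refine A.regret_le_of_forall ρ hb fun i => ?_
  have hgain : ∑ t, relGain b ρ i t ≤ T := by
    simpa using sum_le_card_nsmul univ (relGain b ρ i) 1 fun t _ => (relGain_mem_Icc ρ hb).2
  have hnonneg : 0 ≤ ∫ ω, ∑ t, relGain b ρ (A.alloc ω b ρ t) t ∂A.law :=
    integral_nonneg fun ω => sum_nonneg fun t _ => (relGain_mem_Icc ρ hb).1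
  linarith

end AllocationRule

section Regret

variable {k P Q T : ℕ} [NeZero k] (hT : P * Q ≤ T) {ε : ℝ} {b : Fin k → ℝ}
  (hb : ∀ j, 0 ≤ b j) (ρ : Realization k T)

include hb

namespace Exploration

theorem sum_relGain_round_le (hε : 0 < ε) (e : Exploration k P Q) (i : Fin k) :
    ∑ p, relGain b ρ i (e.round hT p i) ≤
      ∑ p : Fin P, ∑ j, hedge (1 + ε) (e.exploredGain hT b ρ p) j * relGain b ρ j (e.round hT p j) +
        (ε * P + Real.log k / ε) := by
  have h := sum_le_sum_hedge_add hε (x := fun p j => relGain b ρ j (e.round hT p j))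
    (fun _ _ => relGain_mem_Icc ρ hb) univ i
  rwa [card_univ, Fintype.card_fin, Fintype.card_fin] at h

theorem sum_relGain_phaseRound_le [Nonempty (Exploration k P Q)] (hε : 0 < ε) (i : Fin k) :
    ∑ x, relGain b ρ i (phaseRound hT x) ≤
      𝔼 e : Exploration k P Q, ∑ x, ∑ j, e.dist hT ε b ρ (phaseRound hT x) j *
        relGain b ρ j (phaseRound hT x) + Q * (ε * P + Real.log k / ε) := by
  have hbest : Q * 𝔼 e : Exploration k P Q, ∑ p, relGain b ρ i (e.round hT p i) =
      ∑ x, relGain b ρ i (phaseRound hT x) := by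
    simpa using expect_sum_mul_round hT (c := fun _ _ => 1) (fun _ _ _ _ => rfl) (relGain b ρ i) i
  have hfresh (j : Fin k) (p : Fin P) : DependsOn
      (fun e : Exploration k P Q => hedge (1 + ε) (e.exploredGain hT b ρ p) j) {p}ᶜ :=
    fun e e' h => by
      simp only
      rw [exploredGain_congr hT ρ b fun q hq => h q (Fin.ne_of_lt hq)]
  have hhedge : Q * 𝔼 e : Exploration k P Q, ∑ p : Fin P, ∑ j,
      hedge (1 + ε) (e.exploredGain hT b ρ p) j * relGain b ρ j (e.round hT p j) =
      𝔼 e : Exploration k P Q, ∑ x, ∑ j, e.dist hT ε b ρ (phaseRound hT x) j *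
        relGain b ρ j (phaseRound hT x) := by
    simp only [dist_eq_hedge hT _ ρ hε.le, phaseRound_div]
    rw [expect_congr rfl fun e _ => sum_comm (s := univ (α := Fin P)), expect_sum_comm,
      expect_congr rfl fun e _ => sum_comm (s := univ (α := Fin P × Fin Q)), expect_sum_comm,
      mul_sum]
    exact sum_congr rfl fun j _ => expect_sum_mul_round hT (hfresh j) (relGain b ρ j) j
  rw [← hbest, ← hhedge, ← mul_add]
  gcongr
  rw [← Fintype.expect_const (ι := Exploration k P Q) (ε * P + Real.log k / ε),
    ← expect_add_distrib]
  exact expect_le_expect fun e _ => e.sum_relGain_round_le hT hb ρ hε i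

theorem sum_dist_mul_relGain_mem_Icc (hε : 0 ≤ ε) (e : Exploration k P Q) (t : Fin T) :
    ∑ j, e.dist hT ε b ρ t j * relGain b ρ j t ∈ Set.Icc 0 1 := by
  have hdist (j : Fin k) : 0 ≤ e.dist hT ε b ρ t j := (e.dist_pos hT ρ hε b t j).le
  refine ⟨sum_nonneg fun j _ => mul_nonneg (hdist j) (relGain_mem_Icc ρ hb).1, ?_⟩
  rw [← e.sum_dist hT ρ hε b t]
  exact sum_le_sum fun j _ => mul_le_of_le_one_right (hdist j) (relGain_mem_Icc ρ hb).2

theorem sum_dist_mul_relGain_phaseRound_le (hε : 0 ≤ ε) (e : Exploration k P Q) :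
    ∑ x, ∑ j, e.dist hT ε b ρ (phaseRound hT x) j * relGain b ρ j (phaseRound hT x) ≤
      (∑ t, ∫ u, relGain b ρ (psimAlloc hT ε e u b ρ t) t) + P * k := by
  classical
  have hround (t : Fin T) : ∑ j, e.dist hT ε b ρ t j * relGain b ρ j t ≤
      (∫ u, relGain b ρ (psimAlloc hT ε e u b ρ t) t) + if e.IsExplored hT t then 1 else 0 := by
    split_ifs with h
    · exact (e.sum_dist_mul_relGain_mem_Icc hT hb ρ hε t).2.trans
        (le_add_of_nonneg_left (integral_nonneg fun u => (relGain_mem_Icc ρ hb).1))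
    · rw [integral_psimAlloc_of_not_isExplored hT b ρ hε h fun j => relGain b ρ j t, add_zero]
  have hcard : ∑ t, (if e.IsExplored hT t then 1 else 0 : ℝ) ≤ P * k := by
    rw [sum_boole]
    exact_mod_cast e.card_isExplored_le hT
  calc _ ≤ ∑ t, ∑ j, e.dist hT ε b ρ t j * relGain b ρ j t :=
        sum_phaseRound_le hT fun t => (e.sum_dist_mul_relGain_mem_Icc hT hb ρ hε t).1
    _ ≤ _ := (sum_le_sum fun t _ => hround t).trans
        (sum_add_distrib.trans_le (add_le_add_right hcard _))

theorem sum_relGain_le [Nonempty (Exploration k P Q)] (hε : 0 < ε) (i : Fin k) :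
    ∑ t, relGain b ρ i t ≤
      (𝔼 e : Exploration k P Q, ∑ t, ∫ u, relGain b ρ (psimAlloc hT ε e u b ρ t) t) +
        (P * k + Q * (ε * P + Real.log k / ε) + (T - P * Q)) := by
  have hexploit : 𝔼 e : Exploration k P Q, ∑ x, ∑ j, e.dist hT ε b ρ (phaseRound hT x) j *
      relGain b ρ j (phaseRound hT x) ≤
      (𝔼 e : Exploration k P Q, ∑ t, ∫ u, relGain b ρ (psimAlloc hT ε e u b ρ t) t) + P * k := by
    rw [← Fintype.expect_const (ι := Exploration k P Q) (P * k : ℝ), ← expect_add_distrib]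
    exact expect_le_expect fun e _ => e.sum_dist_mul_relGain_phaseRound_le hT hb ρ hε.le
  have hphases := sum_le_sum_phaseRound_add hT (f := relGain b ρ i)
    fun t => (relGain_mem_Icc ρ hb).2
  have hregret := sum_relGain_phaseRound_le (Q := Q) hT hb ρ hε i
  linarith

end Exploration

theorem regret_psim_le (hP : P * k ≤ T) (hε : 0 < ε) :
    (psim k T P ε hP).regret b ρ ≤ maxBid b * (P * k +
      (T / P : ℕ) * (ε * P + Real.log k / ε) + (T - P * (T / P : ℕ))) := by
  have := Exploration.nonempty_of_mul_le hP
  refine AllocationRule.regret_le_of_forall _ ρ hb fun i => ?_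
  rw [integral_sum_psim_alloc hP b ρ fun _ t j => relGain b ρ j t]
  exact Exploration.sum_relGain_le (Nat.mul_div_le T P) hb ρ hε i

end Regret

/-! ### The choice of the parameters -/

section Tuning

/-- The scale `(k log k)^(1/3) T^(2/3)` of the regret bound.  The rate of `tunedPSim` is
`psimScale k T / T`, and unless `T` is small it has `⌊psimScale k T / k⌋` phases. -/
noncomputable def psimScale (k T : ℕ) : ℝ :=
  ((k : ℝ) * Real.log k) ^ (1 / 3 : ℝ) * (T : ℝ) ^ (2 / 3 : ℝ)

variable {k T : ℕ}

theorem mul_log_nonneg (k : ℕ) : 0 ≤ k * Real.log k :=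
  mul_nonneg k.cast_nonneg (Real.log_natCast_nonneg k)

theorem rpow_one_third_pow_three {x : ℝ} (hx : 0 ≤ x) : (x ^ (1 / 3 : ℝ)) ^ 3 = x := by
  simpa using Real.rpow_inv_natCast_pow hx three_ne_zero

theorem rpow_two_thirds_pow_three {x : ℝ} (hx : 0 ≤ x) : (x ^ (2 / 3 : ℝ)) ^ 3 = x ^ 2 := by
  rw [← Real.rpow_mul_natCast hx, ← Real.rpow_natCast]
  norm_num

theorem psimScale_nonneg (k T : ℕ) : 0 ≤ psimScale k T :=
  mul_nonneg (Real.rpow_nonneg (mul_log_nonneg k) _) (by positivity)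

theorem psimScale_pow_three (k T : ℕ) : psimScale k T ^ 3 = k * Real.log k * (T : ℝ) ^ 2 := by
  rw [psimScale, mul_pow, rpow_one_third_pow_three (mul_log_nonneg k),
    rpow_two_thirds_pow_three T.cast_nonneg]

theorem psimRate_nonneg (k T : ℕ) : 0 ≤ psimRate k T :=
  Real.rpow_nonneg (div_nonneg (mul_log_nonneg k) T.cast_nonneg) _

theorem psimRate_eq_div (hT : 0 < T) : psimRate k T = psimScale k T / T := by
  refine (pow_left_inj₀ (psimRate_nonneg k T)
    (div_nonneg (psimScale_nonneg k T) T.cast_nonneg) three_ne_zero).1 ?_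
  rw [psimRate, rpow_one_third_pow_three (div_nonneg (mul_log_nonneg k) T.cast_nonneg), div_pow,
    psimScale_pow_three]
  field_simp

theorem psimPhases_eq_floor (hk : 0 < k) (h : psimScale k T ≤ T) :
    psimPhases k T = ⌊psimScale k T / k⌋₊ := by
  have hscale : Real.log k ^ (1 / 3 : ℝ) * ((T : ℝ) / k) ^ (2 / 3 : ℝ) = psimScale k T / k := by
    have hL := Real.log_natCast_nonneg k
    refine (pow_left_inj₀ (by positivity)
      (div_nonneg (psimScale_nonneg k T) k.cast_nonneg) three_ne_zero).1 ?_
    rw [mul_pow, rpow_one_third_pow_three hL, rpow_two_thirds_pow_three (by positivity), div_pow,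
      div_pow, psimScale_pow_three]
    field_simp
  rw [psimPhases, hscale, min_eq_left]
  rw [← Nat.floor_div_eq_div (K := ℝ)]
  gcongr

theorem le_two_mul_psimScale (h : (T : ℝ) ≤ 8 * (k * Real.log k)) : T ≤ 2 * psimScale k T := by
  refine le_of_pow_le_pow_left₀ three_ne_zero (by linarith [psimScale_nonneg k T]) ?_
  calc (T : ℝ) ^ 3 = T * (T : ℝ) ^ 2 := by ring
    _ ≤ 8 * (k * Real.log k) * (T : ℝ) ^ 2 := by gcongr
    _ = (2 * psimScale k T) ^ 3 := by rw [mul_pow, psimScale_pow_three]; ring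

theorem psimScale_le (h : 8 * (k * Real.log k) ≤ (T : ℝ)) : psimScale k T ≤ T := by
  refine le_of_pow_le_pow_left₀ three_ne_zero T.cast_nonneg ?_
  calc psimScale k T ^ 3 = k * Real.log k * (T : ℝ) ^ 2 := psimScale_pow_three k T
    _ ≤ T * (T : ℝ) ^ 2 := by
        gcongr
        linarith [mul_log_nonneg k]
    _ = (T : ℝ) ^ 3 := by ring

theorem le_psimScale (hk : 2 ≤ k) (h : 8 * (k * Real.log k) ≤ (T : ℝ)) : k ≤ psimScale k T := by
  have hL : 1 / 2 ≤ Real.log k := by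
    have hmono : Real.log 2 ≤ Real.log k := Real.log_le_log two_pos (by exact_mod_cast hk)
    linarith [Real.log_two_gt_d9]
  refine le_of_pow_le_pow_left₀ three_ne_zero (psimScale_nonneg k T) ?_
  calc (k : ℝ) ^ 3 ≤ k * (1 / 2) * (8 * (k * (1 / 2))) ^ 2 := by
        nlinarith [pow_nonneg (k.cast_nonneg : (0 : ℝ) ≤ k) 3]
    _ ≤ k * Real.log k * (8 * (k * Real.log k)) ^ 2 := by gcongr
    _ ≤ k * Real.log k * (T : ℝ) ^ 2 := by gcongr
    _ = psimScale k T ^ 3 := (psimScale_pow_three k T).symm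

variable {P : ℕ}

theorem sub_mul_div_le (hP : 0 < P) : (T : ℝ) - P * (T / P : ℕ) ≤ P := by
  have h : T - P * (T / P) ≤ P := by
    rw [← Nat.mod_eq_sub_mul_div]
    exact (Nat.mod_lt T hP).le
  rw [← Nat.cast_mul, ← Nat.cast_sub (Nat.mul_div_le T P)]
  exact_mod_cast h

theorem div_mul_learning_le (hk : 0 < k) (hT : 0 < T) (hP : 0 < P) (hB : 0 < psimScale k T)
    (h : psimScale k T ≤ 2 * (P * k)) :
    (T / P : ℕ) * (psimRate k T * P + Real.log k / psimRate k T) ≤ 3 * psimScale k T := by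
  have hL : Real.log k = psimScale k T ^ 3 / (k * (T : ℝ) ^ 2) := by
    rw [psimScale_pow_three]
    field_simp
  rw [psimRate_eq_div hT, hL]
  set B := psimScale k T
  calc ((T / P : ℕ) : ℝ) * (B / T * P + B ^ 3 / (k * (T : ℝ) ^ 2) / (B / T))
      ≤ (T : ℝ) / P * (B / T * P + B ^ 3 / (k * (T : ℝ) ^ 2) / (B / T)) := by
        gcongr
        exact Nat.cast_div_le
    _ = B + B * (B / (P * k)) := by field_simp
    _ ≤ B + B * 2 := by
        gcongr
        exact div_le_of_le_mul₀ (by positivity) zero_le_two h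
    _ = 3 * B := by ring

theorem psimPhases_regret_bound_le (hk : 2 ≤ k) (h : 8 * (k * Real.log k) ≤ (T : ℝ)) :
    psimPhases k T * k + (T / psimPhases k T : ℕ) *
        (psimRate k T * psimPhases k T + Real.log k / psimRate k T) +
      (T - psimPhases k T * (T / psimPhases k T : ℕ)) ≤ 5 * psimScale k T := by
  have hk0 : (0 : ℝ) < k := by positivity
  have hkB : k ≤ psimScale k T := le_psimScale hk h
  have hT : 0 < T := by exact_mod_cast (hk0.trans_le hkB).trans_le (psimScale_le h)
  have hfloor := psimPhases_eq_floor (by omega) (psimScale_le h)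
  set P := psimPhases k T
  have hone : 1 ≤ psimScale k T / k := (one_le_div hk0).2 hkB
  have hP : 0 < P := hfloor ▸ Nat.floor_pos.2 hone
  have hexplore : P * k ≤ psimScale k T := by
    rw [← le_div_iff₀ hk0, hfloor]
    exact Nat.floor_le (zero_le_one.trans hone)
  have htwo : psimScale k T ≤ 2 * (P * k) := by
    rw [← mul_assoc, ← div_le_iff₀ hk0, ← div_le_iff₀' two_pos, hfloor]
    exact (Nat.div_two_lt_floor hone).le
  have hlearn := div_mul_learning_le (by omega) hT hP (hk0.trans_le hkB) htwo
  have hrest : (T : ℝ) - P * (T / P : ℕ) ≤ P * k :=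
    (sub_mul_div_le hP).trans (le_mul_of_one_le_right P.cast_nonneg (by exact_mod_cast by omega))
  linarith

end Tuning

theorem regret_tunedPSim_le {k T : ℕ} [NeZero k] {b : Fin k → ℝ} (hb : ∀ j, 0 ≤ b j)
    (ρ : Realization k T) : (tunedPSim k T).regret b ρ ≤ maxBid b * (5 * psimScale k T) := by
  obtain rfl | hk := (Nat.one_le_iff_ne_zero.2 (NeZero.ne k)).eq_or_lt
  · exact (AllocationRule.regret_nonpos_of_subsingleton _ ρ hb).trans
      (mul_nonneg (maxBid_nonneg hb) (by linarith [psimScale_nonneg 1 T]))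
  obtain hshort | hlong := le_total (T : ℝ) (8 * (k * Real.log k))
  · refine (AllocationRule.regret_le_maxBid_mul _ ρ hb).trans
      (mul_le_mul_of_nonneg_left ?_ (maxBid_nonneg hb))
    linarith [le_two_mul_psimScale hshort, psimScale_nonneg k T]
  · have hrate : 0 < psimRate k T := by
      have hk0 : (0 : ℝ) < k := by positivity
      have hscale : 0 < psimScale k T := hk0.trans_le (le_psimScale hk hlong)
      have hT : 0 < T := by exact_mod_cast hscale.trans_le (psimScale_le hlong)
      rw [psimRate_eq_div hT]
      positivity
    exact (regret_psim_le hb ρ _ hrate).trans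
      (mul_le_mul_of_nonneg_left (psimPhases_regret_bound_le hk hlong) (maxBid_nonneg hb))

theorem mainTheorem8 :
    ∃ C : ℝ, 0 < C ∧ ∀ (k T : ℕ) [NeZero k],
      ∃ P : PaymentRule (tunedPSim k T),
        P.IsNormalized ∧ P.IsWeaklyTruthful ∧
          ∀ vmax : ℝ, 0 ≤ vmax →
            (tunedPSim k T).worstCaseRegret vmax ≤
              ((C * ((k : ℝ) * Real.log k) ^ (1 / 3 : ℝ) * (T : ℝ) ^ (2 / 3 : ℝ) * vmax : ℝ) :
                EReal) := by
  refine ⟨5, by norm_num, fun k T _ => ⟨psimPayment k T _ _ _,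
    psimPayment_isNormalized (psimRate_nonneg k T),
    psimPayment_isWeaklyTruthful (psimRate_nonneg k T), fun vmax _ => ?_⟩⟩
  refine iSup_le fun v => iSup_le fun hv => iSup_le fun ρ => EReal.coe_le_coe_iff.2 ?_
  calc (tunedPSim k T).regret v ρ
      ≤ maxBid v * (5 * psimScale k T) := regret_tunedPSim_le (fun j => (hv j).1) ρ
    _ ≤ vmax * (5 * psimScale k T) := mul_le_mul_of_nonneg_right (maxBid_le fun j => (hv j).2)
        (mul_nonneg (by norm_num) (psimScale_nonneg k T))
    _ = 5 * ((k : ℝ) * Real.log k) ^ (1 / 3 : ℝ) * (T : ℝ) ^ (2 / 3 : ℝ) * vmax := by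
        rw [psimScale]
        ring
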